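/- For a unital ring $S$ and $n\ge 3$, let $St_n(S)$ be the Steinberg group: the group generated by symbols $x_{i,j}(r)$ ($r\in S$, $1\le i\ne j\le n$) subject to the relations $x_{i,j}(r)x_{i,j}(s)=x_{i,j}(r+s)$; $[x_{i,j}(r),x_{j,k}(s)]=x_{i,k}(rs)$ for $i,j,k$ distinct; and $[x_{i,j}(r),x_{l,k}(s)]=1$ for $j\ne l$, $i\ne k$, where $[x,y]=x^{-1}y^{-1}xy$. **Theorem 1.3.** Let $n\ge 3$ and $k\ge 0$, let $R=\mathbb Z\langle t_1,\dots,t_k\rangle$ be the ring of non-commutative polynomials over $\mathbb Z$, and let $\Gamma=St_n(R)$. Let $X$ be a non-empty CAT(0) space (a geodesic metric space in which distances between points of geodesic triangles are at most the distances between the corresponding points of Euclidean comparison triangles), and let $H$ be a group acting on $X$ by isometries such that * the action is metrically proper: for every $x\in X$ there is $r>0$ such that $\{g\in H : g\cdot B(x,r)\cap B(x,r)\ne\emptyset\}$ is finite; * the action is cocompact: there is a compact $K\subseteq X$ with $X=\bigcup_{g\in H}gK$. Then every group homomorphism $\phi:\Gamma\to H$ has finite image. Moreover, there is a two-sided ideal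 $U$ of $R$ (depending on $\phi$) such that $R/U$ is finite, $St_n(R/U)$ is finite, and $\phi$ factors through the homomorphism $St_n(R)\to St_n(R/U)$, $x_{i,j}(r)\mapsto x_{i,j}(r+U)$. -/

import Mathlib

/-- Index set of the generators `x_{i,j}(r)` of the Steinberg group: an ordered pair of distinct
indices and a ring element. -/
abbrev SteinbergGen (n : ℕ) (R : Type*) := {p : Fin n × Fin n // p.1 ≠ p.2} × R

/-- The letter `x_{i,j}(r)` in the free group. -/
def steinbergLetter {n : ℕ} {R : Type*} (i j : Fin n) (hij : i ≠ j) (r : R) :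
    FreeGroup (SteinbergGen n R) :=
  FreeGroup.of (⟨(i, j), hij⟩, r)

/-- The Steinberg relators, with the convention `[x, y] = x⁻¹ y⁻¹ x y`. -/
inductive SteinbergRel (n : ℕ) (R : Type*) [Ring R] : FreeGroup (SteinbergGen n R) → Prop
  | add (i j : Fin n) (hij : i ≠ j) (r s : R) :
      SteinbergRel n R
        (steinbergLetter i j hij r * steinbergLetter i j hij s *
          (steinbergLetter i j hij (r + s))⁻¹)
  | comm_mul (i j k : Fin n) (hij : i ≠ j) (hjk : j ≠ k) (hik : i ≠ k) (r s : R) :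
      SteinbergRel n R
        ((steinbergLetter i j hij r)⁻¹ * (steinbergLetter j k hjk s)⁻¹ *
          steinbergLetter i j hij r * steinbergLetter j k hjk s *
          (steinbergLetter i k hik (r * s))⁻¹)
  | comm_one (i j l k : Fin n) (hij : i ≠ j) (hlk : l ≠ k) (hjl : j ≠ l) (hik : i ≠ k) (r s : R) :
      SteinbergRel n R
        ((steinbergLetter i j hij r)⁻¹ * (steinbergLetter l k hlk s)⁻¹ *
          steinbergLetter i j hij r * steinbergLetter l k hlk s)

/-- The Steinberg group `St_n(R)`. -/
abbrev SteinbergGroup (n : ℕ) (R : Type*) [Ring R] : Type _ :=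
  PresentedGroup {w : FreeGroup (SteinbergGen n R) | SteinbergRel n R w}

/-- The map on free groups sending the letter `x_{i,j}(r)` to the element `x_{i,j}(f r)` respects the
Steinberg relators. -/
theorem steinbergRel_lift_eq_one {n : ℕ} {R S : Type*} [Ring R] [Ring S] (f : R →+* S)
    (w : FreeGroup (SteinbergGen n R)) (hw : SteinbergRel n R w) :
    FreeGroup.lift (fun g : SteinbergGen n R =>
      (PresentedGroup.of (g.1, f g.2) : SteinbergGroup n S)) w = 1 := by
  cases hw with
  | add i j hij r s =>
    have h := PresentedGroup.one_of_mem (rels := {w | SteinbergRel n S w})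
      (SteinbergRel.add i j hij (f r) (f s))
    simpa [steinbergLetter, PresentedGroup.of] using h
  | comm_mul i j k hij hjk hik r s =>
    have h := PresentedGroup.one_of_mem (rels := {w | SteinbergRel n S w})
      (SteinbergRel.comm_mul i j k hij hjk hik (f r) (f s))
    simpa [steinbergLetter, PresentedGroup.of] using h
  | comm_one i j l k hij hlk hjl hik r s =>
    have h := PresentedGroup.one_of_mem (rels := {w | SteinbergRel n S w})
      (SteinbergRel.comm_one i j l k hij hlk hjl hik (f r) (f s))
    simpa [steinbergLetter, PresentedGroup.of] using h

/-- The homomorphism `St_n(R) → St_n(S)`, `x_{i,j}(r) ↦ x_{i,j}(f r)`, induced by a ring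
homomorphism `f : R → S`. -/
def SteinbergGroup.map (n : ℕ) {R S : Type*} [Ring R] [Ring S] (f : R →+* S) :
    SteinbergGroup n R →* SteinbergGroup n S :=
  PresentedGroup.toGroup (steinbergRel_lift_eq_one f)

/-- `c`, restricted to `[0, d(x, y)]`, is a geodesic path from `x` to `y`. -/
structure IsGeodesicPath {X : Type*} [MetricSpace X] (c : ℝ → X) (x y : X) : Prop where
  source : c 0 = x
  target : c (dist x y) = y
  isometry : ∀ s ∈ Set.Icc 0 (dist x y), ∀ t ∈ Set.Icc 0 (dist x y),
    dist (c s) (c t) = |s - t|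

/-- CAT(0) spaces: geodesic metric spaces in which the distance between two points on sides of a
geodesic triangle is at most the distance between the comparison points in a comparison triangle
in the Euclidean plane. (Two sides of the triangle with common vertex `p` are given by `c` and `c'`;
for two points on one side the inequality is automatic.) -/
structure IsCATZero (X : Type*) [MetricSpace X] : Prop where
  exists_geodesic : ∀ x y : X, ∃ c : ℝ → X, IsGeodesicPath c x y
  comparison : ∀ (p q r : X) (c c' : ℝ → X), IsGeodesicPath c p q → IsGeodesicPath c' p r →
    ∀ p' q' r' : EuclideanSpace ℝ (Fin 2),
      dist p' q' = dist p q → dist p' r' = dist p r → dist q' r' = dist q r →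
    ∀ s ∈ Set.Icc 0 (dist p q), ∀ t ∈ Set.Icc 0 (dist p r),
    ∀ a b : EuclideanSpace ℝ (Fin 2),
      dist p' a = s → dist a q' = dist p q - s →
      dist p' b = t → dist b r' = dist p r - t →
      dist (c s) (c' t) ≤ dist a b

/-- The action of the discrete group `G` on `X` is metrically proper. -/
def IsMetricallyProperAction (G X : Type*) [Group G] [MetricSpace X] [MulAction G X] : Prop :=
  ∀ x : X, ∃ r > 0,
    {g : G | (((fun y : X => g • y) '' Metric.ball x r) ∩ Metric.ball x r).Nonempty}.Finite

/-- The action of `G` on `X` is cocompact: the translates of some compact set cover `X`. -/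
def IsCocompactAction (G X : Type*) [Group G] [MetricSpace X] [MulAction G X] : Prop :=
  ∃ K : Set X, IsCompact K ∧ ∀ x : X, ∃ g : G, ∃ y ∈ K, g • y = x

/-!
The image of `φ` is controlled root subgroup by root subgroup. Each `z = x_{i,j}(r)` is the
commutator of `x = x_{i,k}(r)` and `y = x_{k,j}(1)`, and `z ^ (m * m)` is the commutator of `x ^ m`
and `y ^ m`. So the image of `z ^ (m * m)` moves points by `O(m)`. In a CAT(0) space squaring an
isometry doubles any lower bound of its displacement, so the displacement of `φ z` has infimum zero,
and for a proper cocompact action this forces `φ z` to have finite order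
(`IsCATZero.isOfFinOrder_of_distorted`). Almost-circumcentres of orbits show that the orders of the
finite subgroups of `H` are bounded (`IsCATZero.exists_bound_card_finite_subgroup`). The image of a
root subgroup is thus a commutative torsion group with finite subgroups of bounded order, hence
finite (`SteinbergGroup.finite_range_root`). Completeness of the space is not needed, because
points that are moved by little serve as well as fixed points.

By the commutator relations the `r` with `φ (x_{i,j}(r)) = 1` for all `i ≠ j` form a two-sided ideal
`U`; the quotient `R / U` embeds into the product of the finite images of the
root subgroups, and `φ` factors through `St_n(R / U)`.

It remains to see that `St_n(S)` is finite for a finite ring `S` (`SteinbergGroup.finite`); then so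
is the image of `φ`. For a simple root `α` let `V` and `N` be generated by the positive roots other
than `α` and the negative roots other than `-α`. The group `L` generated by `x_α` and `x_{-α}`
normalises the finite groups `V` and `N`, which together generate everything since `n ≥ 3`; so `L`
is finite modulo the centre. Tavgen's trick (`finite_of_finite_rank_one`) turns this finiteness in
rank one into finiteness of `St_n(S)` modulo its centre. As `St_n(S)` is perfect, Schur's theorem
finishes the proof.
-/

/-! ### Isometric actions on CAT(0) spaces -/

/-- Every triple of distances satisfying the triangle inequalities is realised in the plane. -/
theorem exists_comparison_triangle {a b c : ℝ} (ha : 0 ≤ a) (hb : 0 ≤ b) (hc : 0 ≤ c)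
    (h1 : a ≤ b + c) (h2 : b ≤ a + c) (h3 : c ≤ a + b) :
    ∃ p q r : EuclideanSpace ℝ (Fin 2), dist p q = a ∧ dist p r = b ∧ dist q r = c := by
  rcases ha.eq_or_lt with rfl | ha
  · obtain rfl : b = c := by linarith
    refine ⟨!₂[0, 0], !₂[0, 0], !₂[b, 0], ?_, ?_, ?_⟩ <;>
      simp [EuclideanSpace.dist_eq, Real.dist_eq, Real.sqrt_sq_eq_abs, abs_of_nonneg hb]
  · set x : ℝ := (a ^ 2 + b ^ 2 - c ^ 2) / (2 * a) with hx
    have hxa : 2 * a * x = a ^ 2 + b ^ 2 - c ^ 2 := by rw [hx]; field_simp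
    have hx1 : x ≤ b := by
      rw [hx, div_le_iff₀ (by linarith)]; nlinarith
    have hx2 : -b ≤ x := by
      rw [hx, le_div_iff₀ (by linarith)]; nlinarith
    have hy : 0 ≤ b ^ 2 - x ^ 2 := by nlinarith
    refine ⟨!₂[0, 0], !₂[a, 0], !₂[x, Real.sqrt (b ^ 2 - x ^ 2)], ?_, ?_, ?_⟩
    · simp [EuclideanSpace.dist_eq, Real.dist_eq, Real.sqrt_sq_eq_abs, abs_of_pos ha]
    · simp [EuclideanSpace.dist_eq, Real.dist_eq, Real.sq_sqrt hy, Real.sqrt_sq_eq_abs,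
        abs_of_nonneg hb]
    · have : (a - x) ^ 2 + (b ^ 2 - x ^ 2) = c ^ 2 := by nlinarith
      simp [EuclideanSpace.dist_eq, Real.dist_eq, Real.sq_sqrt hy, this, Real.sqrt_sq_eq_abs,
        abs_of_nonneg hc]

/-- The Bruhat–Tits (CN) inequality for midpoints in a CAT(0) space. -/
theorem IsCATZero.exists_midpoint {X : Type*} [MetricSpace X] (hX : IsCATZero X) (x y : X) :
    ∃ m : X, ∀ o : X,
      dist m o ^ 2 ≤ dist x o ^ 2 / 2 + dist y o ^ 2 / 2 - dist x y ^ 2 / 4 := by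
  obtain ⟨c, hc⟩ := hX.exists_geodesic x y
  refine ⟨c (dist x y / 2), fun o => ?_⟩
  obtain ⟨c', hc'⟩ := hX.exists_geodesic x o
  obtain ⟨p, q, r, hpq, hpr, hqr⟩ := exists_comparison_triangle
    (dist_nonneg (x := x) (y := y)) (dist_nonneg (x := x) (y := o)) (dist_nonneg (x := y) (y := o))
    (by simpa [dist_comm y o] using dist_triangle x o y) (dist_triangle x y o)
    (by simpa [dist_comm x y] using dist_triangle y x o)
  have hd : 0 ≤ dist x y := dist_nonneg
  have hcomp := hX.comparison x y o c c' hc hc' p q r hpq hpr hqr (dist x y / 2)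
    ⟨by linarith, by linarith⟩ (dist x o) ⟨dist_nonneg, le_rfl⟩ (midpoint ℝ p q) r
    (by rw [dist_left_midpoint (𝕜 := ℝ), hpq]; norm_num; ring)
    (by rw [dist_midpoint_right (𝕜 := ℝ), hpq]; norm_num; ring) hpr (by simp)
  rw [hc'.target] at hcomp
  have happ := EuclideanGeometry.dist_sq_add_dist_sq_eq_two_mul_dist_midpoint_sq_add_half_dist_sq
    r p q
  rw [dist_comm r p, dist_comm r q, hpr, hqr, hpq, dist_comm r] at happ
  nlinarith [pow_le_pow_left₀ dist_nonneg hcomp 2]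

section Displacement

variable {X : Type*} [MetricSpace X] {H : Type*} [Group H] [MulAction H X] [IsIsometricSMul H X]

theorem dist_pow_smul_le (g : H) (x : X) (k : ℕ) : dist x (g ^ k • x) ≤ k * dist x (g • x) := by
  induction k with
  | zero => simp
  | succ k ih =>
    have h : dist (g ^ k • x) (g ^ (k + 1) • x) = dist x (g • x) := by
      rw [pow_succ, mul_smul, dist_smul]
    have := dist_triangle x (g ^ k • x) (g ^ (k + 1) • x)
    push_cast
    linarith

/-- In a CAT(0) space, squaring an isometry at least doubles a lower bound of its displacement. -/
theorem IsCATZero.two_mul_le_dist_sq_smul (hX : IsCATZero X) {g : H} {e : ℝ}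
    (h : ∀ x : X, e ≤ dist x (g • x)) (x : X) : 2 * e ≤ dist x (g ^ 2 • x) := by
  obtain ⟨m, hm⟩ := hX.exists_midpoint x (g • x)
  -- `m` is a midpoint of `x` and `g x`, and `g m` is one of `g x` and `g² x`
  have h1 := hm (g • m)
  have h2 := hm (g⁻¹ • x)
  have h3 := hm x
  have h4 := hm (g • x)
  have e1 : dist (g • x) (g • m) = dist m x := by rw [dist_smul, dist_comm]
  have e2 : dist m (g⁻¹ • x) = dist x (g • m) := by
    rw [← dist_smul g m, smul_inv_smul, dist_comm]
  have e3 : dist (g • x) (g⁻¹ • x) = dist x (g ^ 2 • x) := by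
    rw [← dist_smul g (g • x), smul_inv_smul, ← mul_smul, ← pow_two, dist_comm]
  have e4 : dist x (g⁻¹ • x) = dist x (g • x) := by
    rw [← dist_smul g x, smul_inv_smul, dist_comm]
  rw [e1] at h1
  rw [e2, e3, e4] at h2
  rw [dist_self, dist_comm (g • x) x] at h3
  have h0 := h m
  have h5 : dist m (g • m) ^ 2 ≤ (dist x (g ^ 2 • x) / 2) ^ 2 := by nlinarith
  have h6 := (sq_le_sq₀ dist_nonneg (by positivity)).1 h5
  linarith

theorem IsCATZero.two_pow_mul_le_dist (hX : IsCATZero X) {g : H} {e : ℝ}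
    (h : ∀ x : X, e ≤ dist x (g • x)) (N : ℕ) (x : X) :
    2 ^ N * e ≤ dist x (g ^ 2 ^ N • x) := by
  induction N generalizing x with
  | zero => simpa using h x
  | succ N ih =>
    have := hX.two_mul_le_dist_sq_smul ih x
    rw [← pow_mul, ← pow_succ] at this
    rw [pow_succ]
    linarith

/-- A finite group of isometries of a CAT(0) space moves some point by arbitrarily little: it
suffices to take a point at which the radius of an orbit is almost minimal. -/
theorem IsCATZero.exists_dist_smul_lt [Nonempty X] (hX : IsCATZero X) (F : Subgroup H) [Finite F]
    {e : ℝ} (he : 0 < e) : ∃ x : X, ∀ g ∈ F, dist x (g • x) < e := by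
  obtain ⟨p⟩ := ‹Nonempty X›
  -- `ρ x` is the radius of the smallest ball about `x` that contains the orbit of `p`
  let ρ : X → ℝ := fun x => ⨆ f : F, dist x (f • p)
  have hle : ∀ x (f : F), dist x (f • p) ≤ ρ x := fun x f =>
    le_ciSup (f := fun f : F => dist x (f • p)) (Set.finite_range _).bddAbove f
  have hρ0 : ∀ x, 0 ≤ ρ x := fun x => dist_nonneg.trans (hle x 1)
  have hbdd : BddBelow (Set.range ρ) := ⟨0, by rintro _ ⟨x, rfl⟩; exact hρ0 x⟩
  set r := ⨅ x, ρ x with hr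
  have hr0 : 0 ≤ r := Real.iInf_nonneg hρ0
  have : Nonempty X := ⟨p⟩
  obtain ⟨d, hd0, hd⟩ : ∃ d : ℝ, 0 < d ∧ 4 * (2 * r * d + d ^ 2) < e ^ 2 := by
    refine ⟨min 1 (e ^ 2 / (4 * (2 * r + 2))), lt_min one_pos (by positivity), ?_⟩
    set d := min 1 (e ^ 2 / (4 * (2 * r + 2)))
    have hd1 : d ≤ 1 := min_le_left _ _
    have hd0 : 0 < d := lt_min one_pos (by positivity)
    have hd2 : d * (4 * (2 * r + 2)) ≤ e ^ 2 := by
      rw [← le_div_iff₀ (by positivity)]; exact min_le_right _ _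
    nlinarith
  obtain ⟨x, hx⟩ : ∃ x, ρ x < r + d := exists_lt_of_ciInf_lt (by linarith)
  refine ⟨x, fun g hg => ?_⟩
  obtain ⟨m, hm⟩ := hX.exists_midpoint x (g • x)
  have hgx : ∀ f : F, dist (g • x) (f • p) ≤ ρ x := by
    intro f
    have hf := hle x (⟨g, hg⟩⁻¹ * f)
    rw [← dist_smul g] at hf
    have : g • ((⟨g, hg⟩⁻¹ * f : F) • p) = f • p := by
      rw [Subgroup.smul_def, Subgroup.smul_def, ← mul_smul]; simp
    rwa [this] at hf
  have hρm : ρ m ^ 2 ≤ ρ x ^ 2 - dist x (g • x) ^ 2 / 4 := by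
    obtain ⟨f, hf⟩ := exists_eq_ciSup_of_finite (f := fun f : F => dist m (f • p))
    have hf' : dist m (f • p) = ρ m := hf
    have h1 := hm (f • p)
    have h2 := pow_le_pow_left₀ dist_nonneg (hle x f) 2
    have h3 := pow_le_pow_left₀ dist_nonneg (hgx f) 2
    rw [hf'] at h1
    linarith
  have h1 : r ^ 2 ≤ ρ m ^ 2 := pow_le_pow_left₀ hr0 (ciInf_le hbdd m) 2
  have h2 : ρ x ^ 2 ≤ (r + d) ^ 2 := pow_le_pow_left₀ (hρ0 x) hx.le 2
  exact lt_of_pow_lt_pow_left₀ 2 he.le (by nlinarith)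

/-- For a proper cocompact action there is a uniform bound on the number of group elements that
move a given point by little. -/
theorem exists_uniform_bound (hproper : IsMetricallyProperAction H X)
    (hcocompact : IsCocompactAction H X) :
    ∃ e > 0, ∃ N : ℕ, ∀ x : X, ∃ S : Finset H, S.card ≤ N ∧
      ∀ g : H, dist x (g • x) < e → g ∈ S := by
  obtain ⟨K, hK, hcov⟩ := hcocompact
  choose r hr hfin using hproper
  obtain ⟨t, -, ht⟩ := hK.elim_nhds_subcover (fun x => Metric.ball x (r x / 2))
    (fun x _ => Metric.ball_mem_nhds x (half_pos (hr x)))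
  classical
  obtain ⟨e, he, het⟩ : ∃ e > 0, ∀ x ∈ t, e ≤ r x / 2 := by
    rcases t.eq_empty_or_nonempty with rfl | hne
    · exact ⟨1, one_pos, by simp⟩
    · obtain ⟨x₀, hx₀, hmin⟩ := t.exists_min_image (fun x => r x / 2) hne
      exact ⟨r x₀ / 2, half_pos (hr x₀), hmin⟩
  refine ⟨e, he, t.sup fun x => (hfin x).toFinset.card, fun x => ?_⟩
  obtain ⟨h, y, hy, rfl⟩ := hcov x
  obtain ⟨z, hz, hyz⟩ := Set.mem_iUnion₂.1 (ht hy)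
  refine ⟨(hfin z).toFinset.image fun g => h * g * h⁻¹,
    Finset.card_image_le.trans (Finset.le_sup (f := fun x => (hfin x).toFinset.card) hz), ?_⟩
  intro g hg
  refine Finset.mem_image.2 ⟨h⁻¹ * g * h, ?_, by group⟩
  have hd : dist y ((h⁻¹ * g * h) • y) < e := by
    rw [← dist_smul h y]
    simpa [mul_smul] using hg
  rw [Set.Finite.mem_toFinset]
  have hyz' : dist y z < r z / 2 := hyz
  refine ⟨(h⁻¹ * g * h) • y, ⟨y, ?_, rfl⟩, ?_⟩
  · exact Metric.mem_ball.2 (by linarith [hr z])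
  · refine Metric.mem_ball.2 ?_
    have := dist_triangle ((h⁻¹ * g * h) • y) y z
    rw [dist_comm _ y] at this
    linarith [het z hz]

/-- In a group acting properly and cocompactly, an element whose displacement has infimum zero has
finite order: many of its powers move a common point by little. -/
theorem isOfFinOrder_of_displacement (hproper : IsMetricallyProperAction H X)
    (hcocompact : IsCocompactAction H X) {g : H} (hg : ∀ e > 0, ∃ x : X, dist x (g • x) < e) :
    IsOfFinOrder g := by
  obtain ⟨e, he, N, hN⟩ := exists_uniform_bound hproper hcocompact
  obtain ⟨x, hx⟩ := hg (e / (N + 1)) (by positivity)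
  obtain ⟨S, hSN, hS⟩ := hN x
  by_contra hinf
  have hinj := injective_pow_iff_not_isOfFinOrder.2 hinf
  have hmaps : ∀ k ∈ Finset.range (N + 1), g ^ k ∈ S := by
    intro k hk
    have hk' : (k : ℝ) ≤ N + 1 := by
      have := (Finset.mem_range.1 hk).le
      exact_mod_cast this
    refine hS _ ((dist_pow_smul_le g x k).trans_lt ?_)
    calc (k : ℝ) * dist x (g • x) ≤ (N + 1) * dist x (g • x) :=
          mul_le_mul_of_nonneg_right hk' dist_nonneg
      _ < e := by rw [lt_div_iff₀ (by positivity)] at hx; linarith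
  have := Finset.card_le_card_of_injOn _ hmaps hinj.injOn
  simp at this
  omega

/-- In a group acting properly and cocompactly on a CAT(0) space, the orders of the finite subgroups
are bounded. -/
theorem IsCATZero.exists_bound_card_finite_subgroup [Nonempty X] (hX : IsCATZero X)
    (hproper : IsMetricallyProperAction H X) (hcocompact : IsCocompactAction H X) :
    ∃ N : ℕ, ∀ F : Subgroup H, Finite F → Nat.card F ≤ N := by
  obtain ⟨e, he, N, hN⟩ := exists_uniform_bound hproper hcocompact
  refine ⟨N, fun F _ => ?_⟩
  obtain ⟨x, hx⟩ := hX.exists_dist_smul_lt F he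
  obtain ⟨S, hSN, hS⟩ := hN x
  calc Nat.card F = (F : Set H).ncard := rfl
    _ ≤ (S : Set H).ncard := Set.ncard_le_ncard (fun g hg => hS g (hx g hg)) S.finite_toSet
    _ = S.card := Set.ncard_coe_finset S
    _ ≤ N := hSN

/-- A quadratically distorted element of a group acting properly and cocompactly on a CAT(0) space
has finite order. The Heisenberg group provides the distortion: if `z ^ (m * m)` is the commutator
of `x ^ m` and `y ^ m` for all `m`, then `z ^ (m * m)` moves a point by `O(m)`, whereas a
displacement bounded below by `e > 0` would force at least `m² e` for `m` a power of two. -/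
theorem IsCATZero.isOfFinOrder_of_distorted [Nonempty X] (hX : IsCATZero X)
    (hproper : IsMetricallyProperAction H X) (hcocompact : IsCocompactAction H X) {x y z : H}
    (hz : ∀ m : ℕ, z ^ (m * m) = (x ^ m)⁻¹ * (y ^ m)⁻¹ * x ^ m * y ^ m) : IsOfFinOrder z := by
  refine isOfFinOrder_of_displacement hproper hcocompact (fun e he => ?_)
  by_contra! hlow
  obtain ⟨p⟩ := ‹Nonempty X›
  set D := 2 * (dist p (x • p) + dist p (y • p)) with hD
  have hlin : ∀ m : ℕ, dist p (z ^ (m * m) • p) ≤ m * D := by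
    intro m
    have hmul : ∀ a b : H, dist p ((a * b) • p) ≤ dist p (a • p) + dist p (b • p) := by
      intro a b
      have := dist_triangle p (a • p) ((a * b) • p)
      rwa [mul_smul, dist_smul, ← mul_smul] at this
    have hinv : ∀ a : H, dist p (a⁻¹ • p) = dist p (a • p) := by
      intro a; rw [← dist_smul a, smul_inv_smul, dist_comm]
    rw [hz m]
    have h1 := hmul ((x ^ m)⁻¹ * (y ^ m)⁻¹ * x ^ m) (y ^ m)
    have h2 := hmul ((x ^ m)⁻¹ * (y ^ m)⁻¹) (x ^ m)
    have h3 := hmul ((x ^ m)⁻¹) ((y ^ m)⁻¹)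
    rw [hinv, hinv] at h3
    have h4 := dist_pow_smul_le x p m
    have h5 := dist_pow_smul_le y p m
    rw [hD]
    nlinarith
  obtain ⟨N, hN⟩ := pow_unbounded_of_one_lt (D / e) (one_lt_two (α := ℝ))
  have h1 := hX.two_pow_mul_le_dist hlow (N + N) p
  have h2 := hlin (2 ^ N)
  rw [← pow_add] at h2
  push_cast at h2
  rw [div_lt_iff₀ he] at hN
  have hpos : (0 : ℝ) < 2 ^ N := by positivity
  have h3 : (2 : ℝ) ^ (N + N) * e = 2 ^ N * (2 ^ N * e) := by rw [pow_add]; ring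
  nlinarith [mul_lt_mul_of_pos_left hN hpos]

end Displacement

/-! ### Finiteness criteria for abstract groups -/

section Pointwise

open scoped Pointwise

/-- A finite subgroup generated by two subgroups `A` and `B` is a power of the product set `AB`. -/
theorem Subgroup.exists_coe_sup_eq_mul_pow {G : Type*} [Group G] (A B : Subgroup G)
    [Finite ↥(A ⊔ B)] :
    ∃ m₀ : ℕ, ∀ m ≥ m₀, ((A : Set G) * (B : Set G)) ^ m = ((A ⊔ B : Subgroup G) : Set G) := by
  have h1 : (1 : G) ∈ (A : Set G) * (B : Set G) := ⟨1, A.one_mem, 1, B.one_mem, mul_one 1⟩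
  have hstep : ∀ g ∈ (A : Set G) ∪ B, g ∈ (A : Set G) * (B : Set G) := by
    rintro g (hg | hg)
    · exact ⟨g, hg, 1, B.one_mem, mul_one g⟩
    · exact ⟨1, A.one_mem, g, hg, one_mul g⟩
  have hex : ∀ g ∈ A ⊔ B, ∃ m : ℕ, g ∈ ((A : Set G) * (B : Set G)) ^ m := by
    intro g hg
    rw [Subgroup.sup_eq_closure] at hg
    induction hg using Subgroup.closure_induction_left with
    | one => exact ⟨0, by simp⟩
    | mul_left x hx y _ ih =>
      obtain ⟨m, hm⟩ := ih
      exact ⟨m + 1, by rw [pow_succ']; exact Set.mul_mem_mul (hstep x hx) hm⟩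
    | inv_mul_cancel x hx y _ ih =>
      obtain ⟨m, hm⟩ := ih
      refine ⟨m + 1, ?_⟩
      rw [pow_succ']
      refine Set.mul_mem_mul (hstep _ ?_) hm
      exact hx.imp (fun h => A.inv_mem h) (fun h => B.inv_mem h)
  choose! f hf using hex
  have hfin : ((A ⊔ B : Subgroup G) : Set G).Finite := Set.toFinite _
  obtain ⟨m₀, hm₀⟩ := (hfin.image f).bddAbove
  refine ⟨m₀, fun m hm => Set.Subset.antisymm ?_ fun g hg => ?_⟩
  · have hsub : (A : Set G) * (B : Set G) ⊆ ((A ⊔ B : Subgroup G) : Set G) := by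
      rintro _ ⟨a, ha, b, hb, rfl⟩
      exact mul_mem (Subgroup.mem_sup_left ha) (Subgroup.mem_sup_right hb)
    clear hm
    induction m with
    | zero => simp
    | succ m ih =>
      rw [pow_succ]
      rintro _ ⟨a, ha, b, hb, rfl⟩
      exact mul_mem (ih ha) (hsub hb)
  · exact Set.pow_subset_pow_right h1 ((hm₀ ⟨g, hg, rfl⟩).trans hm) (hf g hg)

/-- Tavgen's trick. Suppose that the finite subgroups `U` and `W` decompose, for every `i`, as
`U = A i * V i` and `W = B i * N i`, where `A i ⊔ B i` is finite and normalises `V i` and `N i`.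
If the subgroups `A i ⊔ B i` generate the group, then the group is finite: for large `m`
the finite set `(U W)ᵐ` equals `(A i B i)ᵐ (V i N i)ᵐ = (A i ⊔ B i) (V i N i)ᵐ`, which is
stable under left multiplication by `A i ⊔ B i`. -/
theorem finite_of_finite_rank_one {G : Type*} [Group G] {ι : Type*} [Finite ι]
    (U W : Subgroup G) [Finite U] [Finite W] (A B V N : ι → Subgroup G)
    (hU : ∀ i, (A i : Set G) * (V i : Set G) = U) (hW : ∀ i, (B i : Set G) * (N i : Set G) = W)
    (hfin : ∀ i, Finite ↥(A i ⊔ B i))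
    (hV : ∀ i, A i ⊔ B i ≤ Subgroup.normalizer (V i : Set G))
    (hN : ∀ i, A i ⊔ B i ≤ Subgroup.normalizer (N i : Set G))
    (htop : ⨆ i, (A i ⊔ B i) = ⊤) : Finite G := by
  cases nonempty_fintype ι
  choose m₀ hm₀ using fun i => Subgroup.exists_coe_sup_eq_mul_pow (A i) (B i)
  obtain ⟨m, hm⟩ : ∃ m, ∀ i, m₀ i ≤ m :=
    ⟨Finset.univ.sup m₀, fun i => Finset.le_sup (Finset.mem_univ i)⟩
  set Y : Set G := ((U : Set G) * (W : Set G)) ^ m with hY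
  have hYfin : Y.Finite := by
    have hUW : ((U : Set G) * (W : Set G)).Finite := (Set.toFinite _).mul (Set.toFinite _)
    clear_value Y
    subst hY
    clear hm
    induction m with
    | zero => simp
    | succ m ih => rw [pow_succ]; exact ih.mul hUW
  have hYi : ∀ i, Y = ((A i ⊔ B i : Subgroup G) : Set G) * ((V i : Set G) * (N i : Set G)) ^ m := by
    intro i
    have hA : (A i : Set G) ⊆ (A i ⊔ B i : Subgroup G) := fun _ h => Subgroup.mem_sup_left h
    have hB : (B i : Set G) ⊆ (A i ⊔ B i : Subgroup G) := fun _ h => Subgroup.mem_sup_right h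
    have cAV : Commute (A i : Set G) (V i : Set G) :=
      Subgroup.set_mul_normalizer_comm _ _ (hA.trans (hV i))
    have cAN : Commute (A i : Set G) (N i : Set G) :=
      Subgroup.set_mul_normalizer_comm _ _ (hA.trans (hN i))
    have cBV : Commute (B i : Set G) (V i : Set G) :=
      Subgroup.set_mul_normalizer_comm _ _ (hB.trans (hV i))
    have cBN : Commute (B i : Set G) (N i : Set G) :=
      Subgroup.set_mul_normalizer_comm _ _ (hB.trans (hN i))
    have hcomm : Commute ((A i : Set G) * (B i : Set G)) ((V i : Set G) * (N i : Set G)) :=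
      (cAV.mul_right cAN).mul_left (cBV.mul_right cBN)
    have hUW : (U : Set G) * (W : Set G) =
        ((A i : Set G) * (B i : Set G)) * ((V i : Set G) * (N i : Set G)) := by
      rw [← hU i, ← hW i, mul_assoc, ← mul_assoc (V i : Set G), ← cBV.eq, mul_assoc, mul_assoc]
    rw [hY, hUW, hcomm.mul_pow, hm₀ i m (hm i)]
  have hmul : ∀ i, ∀ g ∈ A i ⊔ B i, ∀ y ∈ Y, g * y ∈ Y := by
    intro i g hg y hy
    rw [hYi i] at hy ⊢
    obtain ⟨a, ha, b, hb, rfl⟩ := hy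
    exact ⟨g * a, mul_mem hg ha, b, hb, mul_assoc _ _ _⟩
  have h1 : (1 : G) ∈ Y :=
    Set.one_mem_pow ⟨1, U.one_mem, 1, W.one_mem, mul_one 1⟩
  have huniv : ∀ g : G, g ∈ Y := by
    intro g
    have hg : g ∈ ⨆ i, (A i ⊔ B i) := htop ▸ Subgroup.mem_top g
    rw [Subgroup.iSup_eq_closure] at hg
    induction hg using Subgroup.closure_induction_left with
    | one => exact h1
    | mul_left x hx y _ ih =>
      obtain ⟨i, hi⟩ := Set.mem_iUnion.1 hx
      exact hmul i x hi y ih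
    | inv_mul_cancel x hx y _ ih =>
      obtain ⟨i, hi⟩ := Set.mem_iUnion.1 hx
      exact hmul i _ (inv_mem hi) y ih
  exact Set.finite_univ_iff.1 (hYfin.subset fun g _ => huniv g)

/-- A subgroup normalising a finite subgroup `V` acts on it through the finite group `Aut V`. -/
theorem Subgroup.relIndex_centralizer_ne_zero {G : Type*} [Group G] (L V : Subgroup G) [Finite V]
    (h : L ≤ Subgroup.normalizer (V : Set G)) :
    (Subgroup.centralizer (V : Set G)).relIndex L ≠ 0 := by
  have hfin : (Subgroup.centralizer (V : Set G)).relIndex (Subgroup.normalizer (V : Set G)) ≠ 0 := by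
    rw [Subgroup.relIndex, ← Subgroup.normalizerMonoidHom_ker, Subgroup.index_ker]
    have : Finite (MulAut V) := Finite.of_injective (fun f : MulAut V => (f : V → V))
      DFunLike.coe_injective
    exact Nat.card_pos.ne'
  exact Subgroup.relIndex_ne_zero_trans hfin
    (by rw [Subgroup.relIndex_eq_one.2 h]; exact one_ne_zero)

/-- If `V i` and `N i` generate the group, then an element centralising both is central. So the
"rank one" subgroups `A i ⊔ B i` are finite modulo the centre, and Tavgen's trick applies to the
quotient by the centre. -/
theorem finite_quotient_center {G : Type*} [Group G] {ι : Type*} [Finite ι]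
    (U W : Subgroup G) [Finite U] [Finite W] (A B V N : ι → Subgroup G)
    (hU : ∀ i, (A i : Set G) * (V i : Set G) = U) (hW : ∀ i, (B i : Set G) * (N i : Set G) = W)
    (hV : ∀ i, A i ⊔ B i ≤ Subgroup.normalizer (V i : Set G))
    (hN : ∀ i, A i ⊔ B i ≤ Subgroup.normalizer (N i : Set G))
    (hVN : ∀ i, V i ⊔ N i = ⊤)
    (htop : ⨆ i, (A i ⊔ B i) = ⊤) : Finite (G ⧸ Subgroup.center G) := by
  let π : G →* G ⧸ Subgroup.center G := QuotientGroup.mk' (Subgroup.center G)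
  have hVU : ∀ i, (V i : Set G) ⊆ U := fun i g hg => by
    rw [← hU i]; exact ⟨1, (A i).one_mem, g, hg, one_mul g⟩
  have hNW : ∀ i, (N i : Set G) ⊆ W := fun i g hg => by
    rw [← hW i]; exact ⟨1, (B i).one_mem, g, hg, one_mul g⟩
  have hUf : Finite (U.map π) := Set.Finite.image π (Set.toFinite (U : Set G))
  have hWf : Finite (W.map π) := Set.Finite.image π (Set.toFinite (W : Set G))
  refine finite_of_finite_rank_one (U.map π) (W.map π) (fun i => (A i).map π)
    (fun i => (B i).map π) (fun i => (V i).map π) (fun i => (N i).map π) ?_ ?_ ?_ ?_ ?_ ?_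
  · intro i; simp only [Subgroup.coe_map, ← hU i, Set.image_mul]
  · intro i; simp only [Subgroup.coe_map, ← hW i, Set.image_mul]
  · intro i
    have : Finite (V i) := (Set.toFinite (U : Set G)).subset (hVU i)
    have : Finite (N i) := (Set.toFinite (W : Set G)).subset (hNW i)
    have h := Subgroup.relIndex_inf_ne_zero
      (Subgroup.relIndex_centralizer_ne_zero _ _ (hV i))
      (Subgroup.relIndex_centralizer_ne_zero _ _ (hN i))
    have hle : Subgroup.centralizer (V i : Set G) ⊓ Subgroup.centralizer (N i : Set G) ≤
        Subgroup.center G := by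
      intro g hg
      have hle' : V i ⊔ N i ≤ Subgroup.centralizer {g} := sup_le
        (fun v hv => Subgroup.mem_centralizer_singleton_iff.2
          ((Subgroup.mem_centralizer_iff.1 hg.1 v hv)))
        (fun v hv => Subgroup.mem_centralizer_singleton_iff.2
          ((Subgroup.mem_centralizer_iff.1 hg.2 v hv)))
      rw [hVN i] at hle'
      exact Subgroup.mem_center_iff.2 fun x =>
        (Subgroup.mem_centralizer_singleton_iff.1 (hle' (Subgroup.mem_top x)))
    have h' : (Subgroup.center G).relIndex (A i ⊔ B i) ≠ 0 :=
      ne_zero_of_dvd_ne_zero h (Subgroup.relIndex_dvd_of_le_left _ hle)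
    rw [← Subgroup.map_sup]
    have hk : π.ker = Subgroup.center G := QuotientGroup.ker_mk' _
    rw [← hk, Subgroup.relIndex_ker] at h'
    exact Nat.finite_of_card_ne_zero h'
  · intro i
    rw [← Subgroup.map_sup]
    exact (Subgroup.map_mono (hV i)).trans (Subgroup.le_normalizer_map π)
  · intro i
    rw [← Subgroup.map_sup]
    exact (Subgroup.map_mono (hN i)).trans (Subgroup.le_normalizer_map π)
  · simp only [← Subgroup.map_sup]
    rw [← Subgroup.map_iSup, htop, ← MonoidHom.range_eq_map]
    exact MonoidHom.range_eq_top.2 (QuotientGroup.mk'_surjective _)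

/-- Schur's theorem for perfect groups. -/
theorem finite_of_perfect_of_finite_quotient_center {G : Type*} [Group G]
    [Finite (G ⧸ Subgroup.center G)] (h : commutator G = ⊤) : Finite G := by
  have hfin : (commutatorSet G).Finite := by
    refine (Set.finite_range
      (fun p : (G ⧸ Subgroup.center G) × (G ⧸ Subgroup.center G) =>
        p.1.out * p.2.out * p.1.out⁻¹ * p.2.out⁻¹)).subset ?_
    rintro _ ⟨a, b, rfl⟩
    obtain ⟨z, hz⟩ := QuotientGroup.mk_out_eq_mul (Subgroup.center G) a
    obtain ⟨w, hw⟩ := QuotientGroup.mk_out_eq_mul (Subgroup.center G) b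
    refine ⟨(a, b), ?_⟩
    have hz' := Subgroup.mem_center_iff.1 z.2
    have hw' := Subgroup.mem_center_iff.1 w.2
    simp only [hz, hw, commutatorElement_def, mul_inv_rev]
    calc a * (z : G) * (b * w) * ((z : G)⁻¹ * a⁻¹) * ((w : G)⁻¹ * b⁻¹)
        = a * ((z : G) * (b * w)) * ((z : G)⁻¹ * a⁻¹) * ((w : G)⁻¹ * b⁻¹) := by group
      _ = a * b * (w * a⁻¹) * ((w : G)⁻¹ * b⁻¹) := by rw [← hz']; group
      _ = a * b * a⁻¹ * b⁻¹ := by rw [← hw']; group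
  have : Finite (commutatorSet G) := hfin
  have hc : Finite (commutator G) := inferInstance
  rw [h] at hc
  exact Finite.of_equiv _ Subgroup.topEquiv.toEquiv

/-- A commutative torsion subgroup, given as the range of `f`, is finite if the orders of the finite
subgroups of the ambient group are bounded: being commutative and torsion, it equals any of its
finite subgroups of maximal order. -/
theorem finite_range_of_torsion_of_bounded {M H : Type*} [CommGroup M] [Group H] (f : M →* H)
    (htors : ∀ a, IsOfFinOrder (f a)) (N : ℕ)
    (hN : ∀ F : Subgroup H, Finite F → Nat.card F ≤ N) : (Set.range f).Finite := by
  -- a subgroup of `M` with finite image of maximal order has the same image as `M`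
  let P : ℕ → Prop := fun c => ∃ F : Subgroup M, Finite (F.map f) ∧ Nat.card (F.map f) = c
  have hP0 : P 1 := ⟨⊥, by rw [Subgroup.map_bot]; infer_instance, by simp⟩
  classical
  have hbound : ∀ c, P c → c ≤ N := by rintro _ ⟨F, hF, rfl⟩; exact hN _ hF
  have hP := Nat.findGreatest_spec (hbound 1 hP0) hP0
  obtain ⟨F, hF, hcard⟩ := hP
  have hall : ∀ a, f a ∈ F.map f := by
    intro a
    have hz : Finite ((Subgroup.zpowers a).map f) := by
      rw [MonoidHom.map_zpowers]
      exact (htors a).finite_zpowers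
    have hsup : Finite ((F ⊔ Subgroup.zpowers a).map f) := by
      have hset : (((F ⊔ Subgroup.zpowers a).map f : Subgroup H) : Set H) =
          (F.map f : Set H) * ((Subgroup.zpowers a).map f : Set H) := by
        rw [Subgroup.coe_map, Subgroup.mul_normal, Set.image_mul]; rfl
      have : (((F ⊔ Subgroup.zpowers a).map f : Subgroup H) : Set H).Finite := by
        rw [hset]
        exact Set.Finite.mul hF hz
      exact this
    have hle : F.map f ≤ (F ⊔ Subgroup.zpowers a).map f := Subgroup.map_mono le_sup_left
    have hle' : Nat.card ((F ⊔ Subgroup.zpowers a).map f) ≤ Nat.card (F.map f) := by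
      rw [hcard]
      exact Nat.le_findGreatest (hN _ hsup) ⟨_, hsup, rfl⟩
    have heq := Subgroup.eq_of_le_of_card_ge hle hle'
    rw [heq]
    exact Subgroup.mem_map_of_mem f (Subgroup.mem_sup_right (Subgroup.mem_zpowers a))
  exact Set.Finite.subset hF (by rintro _ ⟨a, rfl⟩; exact hall a)

end Pointwise

/-! ### Steinberg groups of finite rings -/

namespace SteinbergGroup

variable {n : ℕ} {R : Type*} [Ring R]

/-- The generator `x_{i,j}(r)` of the Steinberg group. -/
def root (i j : Fin n) (hij : i ≠ j) (r : R) : SteinbergGroup n R :=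
  PresentedGroup.of (⟨(i, j), hij⟩, r)

theorem root_mul (i j : Fin n) (hij : i ≠ j) (r s : R) :
    root i j hij r * root i j hij s = root i j hij (r + s) := by
  have h := PresentedGroup.one_of_mem (rels := {w | SteinbergRel n R w})
    (SteinbergRel.add i j hij r s)
  simp only [map_mul, map_inv] at h
  exact mul_inv_eq_one.1 h

/-- The homomorphism `r ↦ x_{i,j}(r)` from the additive group of the ring. -/
def rootHom (i j : Fin n) (hij : i ≠ j) : Multiplicative R →* SteinbergGroup n R :=
  MonoidHom.mk' (fun r => root i j hij r.toAdd) fun _ _ => (root_mul i j hij _ _).symm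

theorem root_zero (i j : Fin n) (hij : i ≠ j) : root i j hij (0 : R) = 1 :=
  map_one (rootHom (R := R) i j hij)

theorem root_neg (i j : Fin n) (hij : i ≠ j) (r : R) :
    root i j hij (-r) = (root i j hij r)⁻¹ :=
  map_inv (rootHom (R := R) i j hij) (Multiplicative.ofAdd r)

theorem root_pow (i j : Fin n) (hij : i ≠ j) (r : R) (m : ℕ) :
    root i j hij r ^ m = root i j hij (m * r) := by
  have h := map_pow (rootHom (R := R) i j hij) (Multiplicative.ofAdd r) m
  rw [← ofAdd_nsmul, nsmul_eq_mul] at h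
  exact h.symm

theorem root_comm_mul (i j k : Fin n) (hij : i ≠ j) (hjk : j ≠ k) (hik : i ≠ k) (r s : R) :
    (root i j hij r)⁻¹ * (root j k hjk s)⁻¹ * root i j hij r * root j k hjk s =
      root i k hik (r * s) := by
  have h := PresentedGroup.one_of_mem (rels := {w | SteinbergRel n R w})
    (SteinbergRel.comm_mul i j k hij hjk hik r s)
  simp only [map_mul, map_inv] at h
  exact mul_inv_eq_one.1 h

theorem root_commute (i j l k : Fin n) (hij : i ≠ j) (hlk : l ≠ k) (hjl : j ≠ l) (hik : i ≠ k)
    (r s : R) : root i j hij r * root l k hlk s = root l k hlk s * root i j hij r := by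
  have h := PresentedGroup.one_of_mem (rels := {w | SteinbergRel n R w})
    (SteinbergRel.comm_one i j l k hij hlk hjl hik r s)
  simp only [map_mul, map_inv] at h
  have h' : (root i j hij r)⁻¹ * (root l k hlk s)⁻¹ * root i j hij r * root l k hlk s = 1 := h
  rw [mul_assoc, ← mul_inv_rev] at h'
  exact (inv_mul_eq_one.1 h').symm

theorem root_conj_left (i j k : Fin n) (hij : i ≠ j) (hjk : j ≠ k) (hik : i ≠ k) (r s : R) :
    root i j hij r * root j k hjk s * (root i j hij r)⁻¹ =
      root i k hik (r * s) * root j k hjk s := by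
  have h := root_comm_mul i j k hij hjk hik (-r) (-s)
  rw [root_neg, root_neg, inv_inv, inv_inv, neg_mul_neg] at h
  rw [← h]
  group

theorem root_conj_right (k i j : Fin n) (hki : k ≠ i) (hij : i ≠ j) (hkj : k ≠ j) (r s : R) :
    root i j hij r * root k i hki s * (root i j hij r)⁻¹ =
      root k i hki s * root k j hkj (-(s * r)) := by
  have h := root_comm_mul k i j hki hij hkj s (-r)
  rw [root_neg, inv_inv, mul_neg] at h
  rw [← h]
  group

/-- The subgroup generated by the `x_{i,j}(r)` with `P i j`. -/
def rootClosure (R : Type*) [Ring R] (P : Fin n → Fin n → Prop) : Subgroup (SteinbergGroup n R) :=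
  Subgroup.closure {g | ∃ (i j : Fin n) (hij : i ≠ j) (r : R), P i j ∧ g = root i j hij r}

theorem root_mem {P : Fin n → Fin n → Prop} {i j : Fin n} (h : P i j) (hij : i ≠ j) (r : R) :
    root i j hij r ∈ rootClosure R P :=
  Subgroup.subset_closure ⟨i, j, hij, r, h, rfl⟩

theorem rootClosure_le {P : Fin n → Fin n → Prop} {M : Subgroup (SteinbergGroup n R)}
    (h : ∀ (i j : Fin n) (hij : i ≠ j) (r : R), P i j → root i j hij r ∈ M) :
    rootClosure R P ≤ M := by
  refine (Subgroup.closure_le _).2 ?_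
  rintro _ ⟨i, j, hij, r, hP, rfl⟩
  exact h i j hij r hP

theorem rootClosure_sup (P Q : Fin n → Fin n → Prop) :
    rootClosure R P ⊔ rootClosure R Q = rootClosure R fun i j => P i j ∨ Q i j := by
  refine le_antisymm (sup_le ?_ ?_) (rootClosure_le ?_)
  · exact rootClosure_le fun i j hij r h => root_mem (Or.inl h) hij r
  · exact rootClosure_le fun i j hij r h => root_mem (Or.inr h) hij r
  · rintro i j hij r (h | h)
    · exact Subgroup.mem_sup_left (root_mem h hij r)
    · exact Subgroup.mem_sup_right (root_mem h hij r)

theorem root_mem_of_comm {M : Subgroup (SteinbergGroup n R)} {i k j : Fin n}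
    (hik : i ≠ k) (hkj : k ≠ j) (h1 : ∀ r : R, root i k hik r ∈ M)
    (h2 : ∀ r : R, root k j hkj r ∈ M) (hij : i ≠ j) (r : R) : root i j hij r ∈ M := by
  rw [← mul_one r, ← root_comm_mul i k j hik hkj hij r 1]
  exact mul_mem (mul_mem (mul_mem (inv_mem (h1 _)) (inv_mem (h2 _))) (h1 _)) (h2 _)

theorem eq_top_of_root_mem {M : Subgroup (SteinbergGroup n R)}
    (h : ∀ (i j : Fin n) (hij : i ≠ j) (r : R), root i j hij r ∈ M) : M = ⊤ := by
  rw [eq_top_iff, ← PresentedGroup.closure_range_of, Subgroup.closure_le]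
  rintro _ ⟨⟨⟨⟨i, j⟩, hij⟩, r⟩, rfl⟩
  exact h i j hij r

theorem exists_ne_ne (hn : 3 ≤ n) (i j : Fin n) : ∃ k, i ≠ k ∧ k ≠ j := by
  have hcard : ({i, j} : Finset (Fin n)).card < Fintype.card (Fin n) := by
    rw [Fintype.card_fin]
    exact Finset.card_le_two.trans_lt hn
  obtain ⟨k, hk⟩ := Finset.exists_mem_notMem_of_card_lt_card
    (s := {i, j}) (t := Finset.univ) (by simpa using hcard)
  simp only [Finset.mem_insert, Finset.mem_singleton, not_or] at hk
  exact ⟨k, fun h => hk.2.1 h.symm, hk.2.2⟩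

/-- The root subgroup `X_{i,j}` normalises the subgroup attached to a set `P` of roots if `P` is
stable under adding the root `(i, j)` and does not contain the opposite root `(j, i)`. -/
theorem rootClosure_le_normalizer {P : Fin n → Fin n → Prop} {i j : Fin n}
    (h1 : ∀ k, i ≠ k → P j k → P i k) (h2 : ∀ k, k ≠ j → P k i → P k j) (h3 : ¬ P j i) :
    rootClosure R (fun a b => a = i ∧ b = j) ≤
      Subgroup.normalizer (rootClosure R P : Set (SteinbergGroup n R)) := by
  have key : ∀ (hij : i ≠ j) (r : R) (a b : Fin n) (hab : a ≠ b) (s : R), P a b →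
      root i j hij r * root a b hab s * (root i j hij r)⁻¹ ∈ rootClosure R P := by
    intro hij r a b hab s hP
    by_cases ha : a = j
    · subst ha
      have hib : i ≠ b := by rintro rfl; exact h3 hP
      rw [root_conj_left i a b hij hab hib]
      exact mul_mem (root_mem (h1 b hib hP) _ _) (root_mem hP _ _)
    · by_cases hb : b = i
      · subst hb
        rw [root_conj_right a b j hab hij ha]
        exact mul_mem (root_mem hP _ _) (root_mem (h2 a ha hP) _ _)
      · rw [root_commute i j a b hij hab (Ne.symm ha) (Ne.symm hb), mul_inv_cancel_right]
        exact root_mem hP _ _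
  refine rootClosure_le ?_
  rintro _ _ hij r ⟨rfl, rfl⟩
  have hz : Subgroup.closure {g | ∃ r : R, g = root _ _ hij r} ≤
      Subgroup.normalizer (rootClosure R P : Set (SteinbergGroup n R)) := by
    refine Subgroup.le_normalizer_closure_iff.2 ?_
    rintro h hh _ ⟨a, b, hab, s, hP, rfl⟩
    have : h ∈ (rootHom (R := R) _ _ hij).range := by
      refine (Subgroup.closure_le _).2 ?_ hh
      rintro _ ⟨r, rfl⟩
      exact ⟨Multiplicative.ofAdd r, rfl⟩
    obtain ⟨r, rfl⟩ := this
    exact key hij _ a b hab s hP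
  exact hz (Subgroup.subset_closure ⟨r, rfl⟩)

theorem finite_rootClosure_singleton [Finite R] (i j : Fin n) :
    Finite (rootClosure R fun a b => a = i ∧ b = j) := by
  by_cases hij : i = j
  · have : rootClosure R (fun a b => a = i ∧ b = j) = ⊥ := by
      refine eq_bot_iff.2 (rootClosure_le ?_)
      rintro _ _ h r ⟨rfl, rfl⟩
      exact absurd hij h
    rw [this]
    infer_instance
  · have hle : rootClosure R (fun a b => a = i ∧ b = j) ≤ (rootHom (R := R) i j hij).range := by
      refine rootClosure_le ?_
      rintro _ _ h r ⟨rfl, rfl⟩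
      exact ⟨Multiplicative.ofAdd r, rfl⟩
    have hfin : ((rootHom (R := R) i j hij).range : Set (SteinbergGroup n R)).Finite := by
      rw [MonoidHom.coe_range]
      have : Finite (Multiplicative R) := ‹Finite R›
      exact Set.finite_range _
    exact hfin.subset hle

open scoped Pointwise in
theorem coe_rootClosure_mul {P Q : Fin n → Fin n → Prop} {i j : Fin n}
    (hPQ : ∀ a b, Q a b ↔ ((a = i ∧ b = j) ∨ P a b))
    (hnorm : rootClosure R (fun a b => a = i ∧ b = j) ≤
      Subgroup.normalizer (rootClosure R P : Set (SteinbergGroup n R))) :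
    (rootClosure R (fun a b => a = i ∧ b = j) : Set (SteinbergGroup n R)) *
      (rootClosure R P : Set (SteinbergGroup n R)) = rootClosure R Q := by
  rw [← Subgroup.coe_mul_of_left_le_normalizer_right _ _ hnorm, rootClosure_sup]
  congr 2
  funext a b
  exact propext (hPQ a b).symm

/-- For an ordering `σ` of the indices, the unipotent subgroup generated by the `x_{i,j}(r)` with
`σ i < σ j` over a finite ring is finite: adding the roots one by one in lexicographic order, each
new root subgroup normalises the group generated by the previous ones. -/
theorem finite_rootClosure_lt [Finite R] (σ : Fin n → ℕ) (hσ : Function.Injective σ)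
    (hσn : ∀ i, σ i < n) : Finite (rootClosure R fun a b => σ a < σ b) := by
  have key : ∀ m : ℕ, Finite (rootClosure R fun a b => σ a < σ b ∧ σ a * n + σ b < m) := by
    intro m
    induction m with
    | zero =>
      have : rootClosure R (fun a b : Fin n => σ a < σ b ∧ σ a * n + σ b < 0) = ⊥ :=
        eq_bot_iff.2 (rootClosure_le fun i j hij r h => absurd h.2 (Nat.not_lt_zero _))
      rw [this]
      infer_instance
    | succ m ih =>
      by_cases hex : ∃ i j, σ i < σ j ∧ σ i * n + σ j = m
      · obtain ⟨i, j, hij, hm⟩ := hex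
        have hprod := coe_rootClosure_mul (R := R) (i := i) (j := j)
          (P := fun a b => σ a < σ b ∧ σ a * n + σ b < m)
          (Q := fun a b => σ a < σ b ∧ σ a * n + σ b < m + 1) ?_
          (rootClosure_le_normalizer ?_ ?_ ?_)
        · have h1 := finite_rootClosure_singleton (R := R) i j
          have : ((rootClosure R fun a b => σ a < σ b ∧ σ a * n + σ b < m + 1 :
              Subgroup (SteinbergGroup n R)) : Set (SteinbergGroup n R)).Finite := by
            rw [← hprod]
            exact Set.Finite.mul h1 ih
          exact this
        · intro a b
          constructor
          · rintro ⟨hab, hlt⟩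
            rcases Nat.lt_succ_iff_lt_or_eq.1 hlt with hlt | heq
            · exact Or.inr ⟨hab, hlt⟩
            · left
              have hn0 : 0 < n := (Nat.zero_le _).trans_lt (hσn a)
              have e1 := congrArg (· / n) (heq.trans hm.symm)
              have e2 := congrArg (· % n) (heq.trans hm.symm)
              simp only [mul_comm _ n, Nat.mul_add_div hn0, Nat.div_eq_of_lt (hσn _),
                Nat.mul_add_mod, Nat.mod_eq_of_lt (hσn _), add_zero] at e1 e2
              exact ⟨hσ e1, hσ e2⟩
          · rintro (⟨rfl, rfl⟩ | ⟨hab, hlt⟩)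
            · exact ⟨hij, by omega⟩
            · exact ⟨hab, by omega⟩
        · rintro k - ⟨hjk, hlt⟩
          have := Nat.mul_le_mul_right n (Nat.succ_le_of_lt hij)
          have := hσn j
          rw [Nat.succ_mul] at *
          omega
        · rintro k - ⟨hki, hlt⟩
          have := Nat.mul_le_mul_right n (Nat.succ_le_of_lt hki)
          have := hσn j
          rw [Nat.succ_mul] at *
          exact ⟨hki.trans hij, by omega⟩
        · rintro ⟨h, -⟩
          omega
      · have : (fun a b => σ a < σ b ∧ σ a * n + σ b < m + 1) =
            fun a b => σ a < σ b ∧ σ a * n + σ b < m := by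
          funext a b
          refine propext ⟨fun h => ⟨h.1, ?_⟩, fun h => ⟨h.1, by omega⟩⟩
          exact lt_of_le_of_ne (Nat.lt_succ_iff.1 h.2) fun he => hex ⟨a, b, h.1, he⟩
        rw [this]
        exact ih
  have hlast : (fun a b => σ a < σ b ∧ σ a * n + σ b < n * n) = fun a b => σ a < σ b := by
    funext a b
    refine propext ⟨fun h => h.1, fun h => ⟨h, ?_⟩⟩
    have := Nat.mul_le_mul_right n (Nat.succ_le_of_lt (hσn a))
    have := hσn b
    rw [Nat.succ_mul] at *
    omega
  have := key (n * n)
  rwa [hlast] at this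

theorem commutator_eq_top (hn : 3 ≤ n) : commutator (SteinbergGroup n R) = ⊤ := by
  refine eq_top_of_root_mem fun i j hij r => ?_
  obtain ⟨k, hik, hkj⟩ := exists_ne_ne hn i j
  rw [← mul_one r, ← root_comm_mul i k j hik hkj hij r 1]
  have h := Subgroup.commutator_mem_commutator
    (Subgroup.mem_top (root i k hik r)⁻¹) (Subgroup.mem_top (root k j hkj (1 : R))⁻¹)
  rw [commutatorElement_def, inv_inv, inv_inv] at h
  exact h

/-- The roots `(i, i + 1)` and `(i + 1, i)` generate the Steinberg group. -/
theorem iSup_simple_eq_top :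
    ⨆ p : {p : Fin n × Fin n // p.2.val = p.1.val + 1},
      (rootClosure R (fun a b => a = p.1.1 ∧ b = p.1.2) ⊔
        rootClosure R (fun a b => a = p.1.2 ∧ b = p.1.1)) = ⊤ := by
  set M := ⨆ p : {p : Fin n × Fin n // p.2.val = p.1.val + 1},
      (rootClosure R (fun a b => a = p.1.1 ∧ b = p.1.2) ⊔
        rootClosure R (fun a b => a = p.1.2 ∧ b = p.1.1)) with hM
  have hsimple : ∀ i j : Fin n, j.val = i.val + 1 →
      (∀ (hij : i ≠ j) (r : R), root i j hij r ∈ M) ∧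
      (∀ (hji : j ≠ i) (r : R), root j i hji r ∈ M) := fun i j h =>
    ⟨fun hij r => Subgroup.mem_iSup_of_mem ⟨(i, j), h⟩
        (Subgroup.mem_sup_left (root_mem ⟨rfl, rfl⟩ hij r)),
      fun hij r => Subgroup.mem_iSup_of_mem ⟨(i, j), h⟩
        (Subgroup.mem_sup_right (root_mem ⟨rfl, rfl⟩ hij r))⟩
  have key : ∀ (d : ℕ) (i j : Fin n), j.val = i.val + d + 1 →
      (∀ (hij : i ≠ j) (r : R), root i j hij r ∈ M) ∧
      (∀ (hji : j ≠ i) (r : R), root j i hji r ∈ M) := by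
    intro d
    induction d with
    | zero => exact hsimple
    | succ d ih =>
      intro i j hd
      obtain ⟨k, hk⟩ : ∃ k : Fin n, k.val = i.val + 1 := ⟨⟨i.val + 1, by omega⟩, rfl⟩
      have h1 := hsimple i k hk
      have h2 := ih k j (by omega)
      have hik : i ≠ k := by rintro rfl; omega
      have hkj : k ≠ j := by rintro rfl; omega
      exact ⟨root_mem_of_comm hik hkj (h1.1 hik) (h2.1 hkj),
        root_mem_of_comm hkj.symm hik.symm (h2.2 hkj.symm) (h1.2 hik.symm)⟩
  refine eq_top_of_root_mem fun i j hij r => ?_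
  rcases lt_or_gt_of_ne (fun h => hij (Fin.ext h) : i.val ≠ j.val) with h | h
  · exact (key (j.val - i.val - 1) i j (by omega)).1 hij r
  · exact (key (i.val - j.val - 1) j i (by omega)).2 hij r

/-- The Steinberg group `St_n(R)`, `n ≥ 3`, of a finite ring is finite. Tavgen's trick, applied to
the decompositions of the two opposite unipotent subgroups with respect to the simple roots
`(i, i + 1)`, shows that the quotient by the centre is finite; as the group is perfect, it is finite
by Schur's theorem. -/
theorem finite [Finite R] (hn : 3 ≤ n) : Finite (SteinbergGroup n R) := by
  have hU : Finite (rootClosure R fun a b : Fin n => a.val < b.val) :=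
    finite_rootClosure_lt Fin.val Fin.val_injective Fin.is_lt
  have hW : Finite (rootClosure R fun a b : Fin n => b.val < a.val) := by
    have h := finite_rootClosure_lt (R := R) (fun i : Fin n => (Fin.rev i).val)
      (Fin.val_injective.comp Fin.rev_injective) (fun i => (Fin.rev i).is_lt)
    have heq : (fun a b : Fin n => (Fin.rev a).val < (Fin.rev b).val) =
        fun a b : Fin n => b.val < a.val := by
      funext a b
      exact propext Fin.rev_lt_rev
    rwa [heq] at h
  let ι := {p : Fin n × Fin n // p.2.val = p.1.val + 1}
  let A : ι → Subgroup (SteinbergGroup n R) := fun p =>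
    rootClosure R fun a b => a = p.1.1 ∧ b = p.1.2
  let B : ι → Subgroup (SteinbergGroup n R) := fun p =>
    rootClosure R fun a b => a = p.1.2 ∧ b = p.1.1
  let V : ι → Subgroup (SteinbergGroup n R) := fun p =>
    rootClosure R fun a b => a.val < b.val ∧ ¬ (a = p.1.1 ∧ b = p.1.2)
  let N : ι → Subgroup (SteinbergGroup n R) := fun p =>
    rootClosure R fun a b => b.val < a.val ∧ ¬ (a = p.1.2 ∧ b = p.1.1)
  have hAV : ∀ p, A p ≤ Subgroup.normalizer (V p : Set (SteinbergGroup n R)) := by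
    rintro ⟨⟨i, j⟩, h⟩
    replace h : j.val = i.val + 1 := h
    refine rootClosure_le_normalizer ?_ ?_ ?_ <;> simp only [Fin.ext_iff] at * <;> omega
  have hBV : ∀ p, B p ≤ Subgroup.normalizer (V p : Set (SteinbergGroup n R)) := by
    rintro ⟨⟨i, j⟩, h⟩
    replace h : j.val = i.val + 1 := h
    refine rootClosure_le_normalizer ?_ ?_ ?_ <;>
      simp only [Fin.ext_iff, not_true_eq_false, and_self, and_false, not_false_eq_true] at * <;>
      omega
  have hAN : ∀ p, A p ≤ Subgroup.normalizer (N p : Set (SteinbergGroup n R)) := by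
    rintro ⟨⟨i, j⟩, h⟩
    replace h : j.val = i.val + 1 := h
    refine rootClosure_le_normalizer ?_ ?_ ?_ <;>
      simp only [Fin.ext_iff, not_true_eq_false, and_self, and_false, not_false_eq_true] at * <;>
      omega
  have hBN : ∀ p, B p ≤ Subgroup.normalizer (N p : Set (SteinbergGroup n R)) := by
    rintro ⟨⟨i, j⟩, h⟩
    replace h : j.val = i.val + 1 := h
    refine rootClosure_le_normalizer ?_ ?_ ?_ <;> simp only [Fin.ext_iff] at * <;> omega
  have hquot := finite_quotient_center (rootClosure R fun a b : Fin n => a.val < b.val)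
    (rootClosure R fun a b : Fin n => b.val < a.val) A B V N
    (fun p => coe_rootClosure_mul (by
      obtain ⟨⟨i, j⟩, h⟩ := p
      replace h : j.val = i.val + 1 := h
      intro a b
      simp only [Fin.ext_iff] at *
      omega) (hAV p))
    (fun p => coe_rootClosure_mul (by
      obtain ⟨⟨i, j⟩, h⟩ := p
      replace h : j.val = i.val + 1 := h
      intro a b
      simp only [Fin.ext_iff] at *
      omega) (hBN p))
    (fun p => sup_le (hAV p) (hBV p)) (fun p => sup_le (hAN p) (hBN p)) (fun p => by
      have hmem : ∀ (a b : Fin n) (hab : a ≠ b) (r : R),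
          ¬ (a = p.1.1 ∧ b = p.1.2) → ¬ (a = p.1.2 ∧ b = p.1.1) →
            root a b hab r ∈ V p ⊔ N p := by
        intro a b hab r h1 h2
        rcases lt_or_gt_of_ne (fun h => hab (Fin.ext h) : a.val ≠ b.val) with h | h
        · exact Subgroup.mem_sup_left (root_mem ⟨h, h1⟩ hab r)
        · exact Subgroup.mem_sup_right (root_mem ⟨h, h2⟩ hab r)
      refine eq_top_of_root_mem fun a b hab r => ?_
      by_cases h : (a = p.1.1 ∧ b = p.1.2) ∨ (a = p.1.2 ∧ b = p.1.1)
      · -- a third index writes the missing root as a commutator of two others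
        obtain ⟨k, hak, hkb⟩ := exists_ne_ne hn a b
        refine root_mem_of_comm hak hkb (fun r => hmem _ _ _ _ ?_ ?_)
          (fun r => hmem _ _ _ _ ?_ ?_) hab r <;> grind
      · rw [not_or] at h
        exact hmem a b hab r h.1 h.2)
    iSup_simple_eq_top
  exact finite_of_perfect_of_finite_quotient_center (commutator_eq_top hn)

end SteinbergGroup

/-! ### Homomorphisms from Steinberg groups -/

namespace SteinbergGroup

variable {n : ℕ} {R : Type*} [Ring R] {H : Type*} [Group H]

/-- For `n ≥ 3` and a homomorphism `φ` on `St_n(R)`, the elements `r` such that `φ` kills all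
`x_{i,j}(r)`, as a left ideal of `R`. -/
def kernelIdeal (hn : 3 ≤ n) (φ : SteinbergGroup n R →* H) : Ideal R where
  carrier := {r | ∀ (i j : Fin n) (hij : i ≠ j), φ (root i j hij r) = 1}
  zero_mem' i j hij := by rw [root_zero, map_one]
  add_mem' ha hb i j hij := by rw [← root_mul, map_mul, ha i j hij, hb i j hij, one_mul]
  smul_mem' s r hr i j hij := by
    obtain ⟨k, hik, hkj⟩ := exists_ne_ne hn i j
    rw [smul_eq_mul, ← root_comm_mul i k j hik hkj hij]
    simp [hr k j hkj]

theorem mem_kernelIdeal (hn : 3 ≤ n) (φ : SteinbergGroup n R →* H) {r : R} :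
    r ∈ kernelIdeal hn φ ↔ ∀ (i j : Fin n) (hij : i ≠ j), φ (root i j hij r) = 1 := Iff.rfl

instance isTwoSided_kernelIdeal (hn : 3 ≤ n) (φ : SteinbergGroup n R →* H) :
    (kernelIdeal hn φ).IsTwoSided where
  mul_mem_of_left {r} s hr := by
    intro i j hij
    obtain ⟨k, hik, hkj⟩ := exists_ne_ne hn i j
    rw [← root_comm_mul i k j hik hkj hij]
    simp [(mem_kernelIdeal hn φ).1 hr i k hik]

theorem map_root_eq_of_mk_eq (hn : 3 ≤ n) (φ : SteinbergGroup n R →* H) {r s : R}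
    (h : Ideal.Quotient.mk (kernelIdeal hn φ) r = Ideal.Quotient.mk (kernelIdeal hn φ) s)
    (i j : Fin n) (hij : i ≠ j) : φ (root i j hij r) = φ (root i j hij s) := by
  have hmem := (mem_kernelIdeal hn φ).1 (Ideal.Quotient.eq.1 h) i j hij
  rw [sub_eq_add_neg, ← root_mul, root_neg, map_mul, map_inv] at hmem
  exact mul_inv_eq_one.1 hmem

/-- If the image of every root subgroup is finite, then so is `R / kernelIdeal`, as it embeds into
the product of these images. -/
theorem finite_quotient_kernelIdeal (hn : 3 ≤ n) (φ : SteinbergGroup n R →* H)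
    (hfin : ∀ (i j : Fin n) (hij : i ≠ j), (Set.range fun r => φ (root i j hij r)).Finite) :
    Finite (R ⧸ kernelIdeal hn φ) := by
  let P := {p : Fin n × Fin n // p.1 ≠ p.2}
  have : ∀ p : P, Finite (Set.range fun r => φ (root p.1.1 p.1.2 p.2 r)) :=
    fun p => hfin _ _ p.2
  refine Finite.of_injective (β := ∀ p : P, Set.range fun r => φ (root p.1.1 p.1.2 p.2 r))
    (fun r p => ⟨φ (root p.1.1 p.1.2 p.2 r.out), r.out, rfl⟩) ?_
  intro r s h
  have hrs : r.out - s.out ∈ kernelIdeal hn φ := by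
    intro i j hij
    have := congrArg Subtype.val (congrFun h ⟨(i, j), hij⟩)
    rw [sub_eq_add_neg, ← root_mul, root_neg, map_mul, map_inv]
    exact mul_inv_eq_one.2 this
  have := Ideal.Quotient.eq.2 hrs
  rwa [Ideal.Quotient.mk_out, Ideal.Quotient.mk_out] at this

theorem exists_eq_comp_map (hn : 3 ≤ n) (φ : SteinbergGroup n R →* H) :
    ∃ ψ : SteinbergGroup n (R ⧸ kernelIdeal hn φ) →* H,
      φ = ψ.comp (SteinbergGroup.map n (Ideal.Quotient.mk (kernelIdeal hn φ))) := by
  let f : SteinbergGen n (R ⧸ kernelIdeal hn φ) → H := fun g =>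
    φ (root g.1.1.1 g.1.1.2 g.1.2 g.2.out)
  have hf : ∀ (i j : Fin n) (hij : i ≠ j) (a : R ⧸ kernelIdeal hn φ) (r : R),
      a = Ideal.Quotient.mk _ r → f (⟨(i, j), hij⟩, a) = φ (root i j hij r) := by
    rintro i j hij _ r rfl
    exact map_root_eq_of_mk_eq hn φ (Ideal.Quotient.mk_out _) i j hij
  have hrel : ∀ w ∈ {w | SteinbergRel n (R ⧸ kernelIdeal hn φ) w}, FreeGroup.lift f w = 1 := by
    intro w hw
    cases hw with
    | add i j hij r s =>
      obtain ⟨r, rfl⟩ := Ideal.Quotient.mk_surjective r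
      obtain ⟨s, rfl⟩ := Ideal.Quotient.mk_surjective s
      simp only [steinbergLetter, map_mul, map_inv, FreeGroup.lift_apply_of]
      rw [hf i j hij _ r rfl, hf i j hij _ s rfl, hf i j hij _ (r + s) (map_add _ _ _).symm,
        ← map_mul, root_mul, mul_inv_cancel]
    | comm_mul i j k hij hjk hik r s =>
      obtain ⟨r, rfl⟩ := Ideal.Quotient.mk_surjective r
      obtain ⟨s, rfl⟩ := Ideal.Quotient.mk_surjective s
      simp only [steinbergLetter, map_mul, map_inv, FreeGroup.lift_apply_of]
      rw [hf i j hij _ r rfl, hf j k hjk _ s rfl, hf i k hik _ (r * s) (map_mul _ _ _).symm,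
        ← root_comm_mul i j k hij hjk hik]
      simp only [map_mul, map_inv, mul_inv_cancel]
    | comm_one i j l k hij hlk hjl hik r s =>
      obtain ⟨r, rfl⟩ := Ideal.Quotient.mk_surjective r
      obtain ⟨s, rfl⟩ := Ideal.Quotient.mk_surjective s
      simp only [steinbergLetter, map_mul, map_inv, FreeGroup.lift_apply_of]
      rw [hf i j hij _ r rfl, hf l k hlk _ s rfl, mul_assoc, ← mul_inv_rev, ← map_mul, ← map_mul,
        root_commute i j l k hij hlk hjl hik, inv_mul_cancel]
  refine ⟨PresentedGroup.toGroup hrel, PresentedGroup.ext ?_⟩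
  rintro ⟨⟨⟨i, j⟩, hij⟩, r⟩
  rw [MonoidHom.comp_apply, SteinbergGroup.map, PresentedGroup.toGroup.of,
    PresentedGroup.toGroup.of]
  exact (hf i j hij _ r rfl).symm

/-- In a homomorphism to a group acting properly and cocompactly on a CAT(0) space, each root
subgroup has finite image: its elements are distorted in Heisenberg subgroups, so their images have
finite order, and finite subgroups of the target have bounded order. -/
theorem finite_range_root (hn : 3 ≤ n) {X : Type*} [MetricSpace X] [Nonempty X] (hX : IsCATZero X)
    [MulAction H X] [IsIsometricSMul H X]
    (hproper : IsMetricallyProperAction H X) (hcocompact : IsCocompactAction H X)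
    (φ : SteinbergGroup n R →* H) (i j : Fin n) (hij : i ≠ j) :
    (Set.range fun r => φ (root i j hij r)).Finite := by
  obtain ⟨N, hN⟩ := hX.exists_bound_card_finite_subgroup hproper hcocompact
  refine finite_range_of_torsion_of_bounded (φ.comp (rootHom i j hij)) (fun r => ?_) N hN
  obtain ⟨k, hik, hkj⟩ := exists_ne_ne hn i j
  refine hX.isOfFinOrder_of_distorted hproper hcocompact (x := φ (root i k hik r.toAdd))
    (y := φ (root k j hkj 1)) fun m => ?_
  change φ (root i j hij r.toAdd) ^ (m * m) = _
  simp only [← map_pow, ← map_inv, ← map_mul, root_pow]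
  rw [root_comm_mul i k j hik hkj hij, mul_one, mul_assoc, ← (Nat.cast_commute m r.toAdd).eq,
    ← mul_assoc, Nat.cast_mul]

end SteinbergGroup

theorem theorem1p3 (n : ℕ) (hn : 3 ≤ n) (k : ℕ)
    {X : Type*} [MetricSpace X] [Nonempty X] (hX : IsCATZero X)
    {H : Type*} [Group H] [MulAction H X] [IsIsometricSMul H X]
    (hproper : IsMetricallyProperAction H X) (hcocompact : IsCocompactAction H X)
    (φ : SteinbergGroup n (FreeAlgebra ℤ (Fin k)) →* H) :
    (Set.range φ).Finite ∧
    ∃ (U : Ideal (FreeAlgebra ℤ (Fin k))) (_ : U.IsTwoSided),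
      Finite (FreeAlgebra ℤ (Fin k) ⧸ U) ∧
      Finite (SteinbergGroup n (FreeAlgebra ℤ (Fin k) ⧸ U)) ∧
      ∃ ψ : SteinbergGroup n (FreeAlgebra ℤ (Fin k) ⧸ U) →* H,
        φ = ψ.comp (SteinbergGroup.map n (Ideal.Quotient.mk U)) := by
  have hquot := SteinbergGroup.finite_quotient_kernelIdeal hn φ
    (SteinbergGroup.finite_range_root hn hX hproper hcocompact φ)
  have hSt := SteinbergGroup.finite
    (R := FreeAlgebra ℤ (Fin k) ⧸ SteinbergGroup.kernelIdeal hn φ) hn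
  obtain ⟨ψ, hψ⟩ := SteinbergGroup.exists_eq_comp_map hn φ
  refine ⟨?_, SteinbergGroup.kernelIdeal hn φ, inferInstance, hquot, hSt, ψ, hψ⟩
  refine (Set.finite_range ψ).subset ?_
  rintro _ ⟨g, rfl⟩
  exact ⟨_, (DFunLike.congr_fun hψ g).symm⟩
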